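/- Let $k$ be a field, let $\ell \ge 7$ be an integer with $\gcd(3,\ell)=1$, and let $A = k[[t^3,t^\ell]] \subseteq k[[t]]$ be the semigroup ring over $k$ of the numerical semigroup $H=\langle 3,\ell\rangle$, that is, the ring of all power series $\sum_{n\in H} c_n t^n$ with $c_n\in k$. It is a one-dimensional Cohen–Macaulay local ring; let $\mathfrak m$ be its maximal ideal. An $\mathfrak m$-primary ideal $I$ of $A$ is called an Ulrich ideal if it contains a parameter ideal $Q$ (an $\mathfrak m$-primary ideal generated by $\dim A = 1$ element) such that $I\neq Q$ and $I^2=QI$, and if $I/I^2$ is a free $A/I$-module. Let $\mathcal X_A$ be the set of all Ulrich ideals of $A$. Then: 1. $\mathcal X_A\neq\emptyset$. 2. $\mathcal X_A$ is finite if and only if $k$ is finite. 3. $A$ contains no Ulrich ideal generated by monomials in $t$ (powers of $t$) if and only if $\ell = 3n+1$ for some even integer $n\ge 2$ or $\ell=3n+2$ for some odd integer $n\ge 3$. -/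

import Mathlib

/-- A parameter ideal of a local ring `(A, 𝔪)`: an `𝔪`-primary ideal generated by `dim A` elements.
(An ideal of a local ring is `𝔪`-primary if and only if its radical is `𝔪`.) -/
def IsParameterIdeal {A : Type*} [CommRing A] [IsLocalRing A] (Q : Ideal A) : Prop :=
  Q.radical = IsLocalRing.maximalIdeal A ∧
    ∃ s : Finset A, (s.card : WithBot ℕ∞) = ringKrullDim A ∧ Ideal.span (s : Set A) = Q

/-- An Ulrich ideal of a (Cohen-Macaulay) local ring `(A, 𝔪)`: an `𝔪`-primary ideal `I` which
contains a parameter ideal `Q` with `I ≠ Q` and `I ^ 2 = Q I` (so `Q` is a reduction of `I`),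
and such that `I / I ^ 2` is a free `A / I`-module. -/
def IsUlrichIdeal {A : Type*} [CommRing A] [IsLocalRing A] (I : Ideal A) : Prop :=
  I.radical = IsLocalRing.maximalIdeal A ∧
    (∃ Q : Ideal A, IsParameterIdeal Q ∧ Q ≤ I ∧ I ≠ Q ∧ I ^ 2 = Q * I) ∧
    Module.Free (A ⧸ I) I.Cotangent

/-- The set `𝒳_A` of all Ulrich ideals of a local ring `A`. -/
def ulrichIdeals (A : Type*) [CommRing A] [IsLocalRing A] : Set (Ideal A) :=
  {I | IsUlrichIdeal I}

/-- The semigroup ring `k[[H]] ⊆ k[[t]]` of a submonoid `H` of `ℕ`: the subalgebra of all power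
series in which only monomials `t ^ n` with `n ∈ H` occur. For `H = ⟨a₁, …, aᵣ⟩` this is the ring
`k[[t ^ a₁, …, t ^ aᵣ]]` of all power series in `t ^ a₁, …, t ^ aᵣ`. -/
def semigroupRing (k : Type*) [Field k] (H : AddSubmonoid ℕ) : Subalgebra k (PowerSeries k) where
  carrier := {f | ∀ n, PowerSeries.coeff n f ≠ 0 → n ∈ H}
  mul_mem' := by
    intro f g hf hg n hn
    rw [PowerSeries.coeff_mul] at hn
    obtain ⟨p, hp, hpn⟩ := Finset.exists_ne_zero_of_sum_ne_zero hn
    rw [← Finset.HasAntidiagonal.mem_antidiagonal.mp hp]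
    exact H.add_mem (hf _ (left_ne_zero_of_mul hpn)) (hg _ (right_ne_zero_of_mul hpn))
  add_mem' := by
    intro f g hf hg n hn
    by_cases h : PowerSeries.coeff n f = 0
    · exact hg n (by simpa [h] using hn)
    · exact hf n h
  algebraMap_mem' := by
    intro r n hn
    rcases Nat.eq_zero_or_pos n with h | h
    · rw [h]; exact H.zero_mem
    · exact absurd (by simp [PowerSeries.coeff_C, h.ne']) hn

theorem mem_semigroupRing {k : Type*} [Field k] {H : AddSubmonoid ℕ} {f : PowerSeries k} :
    f ∈ semigroupRing k H ↔ ∀ n, PowerSeries.coeff n f ≠ 0 → n ∈ H := Iff.rfl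

theorem inv_mem_semigroupRing {k : Type*} [Field k] {H : AddSubmonoid ℕ} {f : PowerSeries k}
    (hf : f ∈ semigroupRing k H) : f⁻¹ ∈ semigroupRing k H := by
  rw [mem_semigroupRing] at hf ⊢
  intro n
  induction n using Nat.strong_induction_on with
  | _ n ih =>
    intro hn
    rw [PowerSeries.coeff_inv] at hn
    split_ifs at hn with h0
    · rw [h0]; exact H.zero_mem
    · obtain ⟨p, hp, hpn⟩ := Finset.exists_ne_zero_of_sum_ne_zero (right_ne_zero_of_mul hn)
      split_ifs at hpn with hlt
      · rw [← Finset.HasAntidiagonal.mem_antidiagonal.mp hp]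
        exact H.add_mem (hf _ (left_ne_zero_of_mul hpn)) (ih _ hlt (right_ne_zero_of_mul hpn))
      · exact absurd rfl hpn

theorem isUnit_semigroupRing {k : Type*} [Field k] {H : AddSubmonoid ℕ} (f : semigroupRing k H)
    (hf : PowerSeries.constantCoeff (f : PowerSeries k) ≠ 0) : IsUnit f := by
  refine IsUnit.of_mul_eq_one
    (⟨(f : PowerSeries k)⁻¹, inv_mem_semigroupRing f.2⟩ : semigroupRing k H) ?_
  exact Subtype.ext (PowerSeries.mul_inv_cancel _ hf)

instance semigroupRing_isLocalRing (k : Type*) [Field k] (H : AddSubmonoid ℕ) :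
    IsLocalRing (semigroupRing k H) := by
  refine IsLocalRing.of_isUnit_or_isUnit_one_sub_self fun f => ?_
  by_cases h : PowerSeries.constantCoeff (f : PowerSeries k) = 0
  · exact Or.inr (isUnit_semigroupRing _ (by simp [h]))
  · exact Or.inl (isUnit_semigroupRing _ h)

/-- An ideal of `k[[H]]` is generated by monomials in `t` if it is generated by a set of elements
each of which is a power `t ^ n` of `t`. -/
def IsMonomialIdeal {k : Type*} [Field k] {H : AddSubmonoid ℕ} (I : Ideal (semigroupRing k H)) :
    Prop :=
  ∃ S : Set (semigroupRing k H),
    (∀ f ∈ S, ∃ n : ℕ, (f : PowerSeries k) = PowerSeries.X ^ n) ∧ I = Ideal.span S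

/-!
Write `A = k[[t ^ 3, t ^ l]]`, `X = t ^ 3`, `Y = t ^ l`, so that `Y ^ 3 = X ^ l`.

*Producing Ulrich ideals.* In a one-dimensional domain, an ideal `I = (f, g)` with
`g ^ 2 ∈ f I` and `(f) : g ⊆ I` is Ulrich, since then `f` and `g` form a basis of `I / I ^ 2`
(`semigroupRing.isUlrichIdeal_span_pair`). For each `c ≠ 0` this applies to
`I_c = (X ^ 2 - c Y, X Y)` (`semigroupRing.isUlrichIdeal_fam`). The ideal `I_c` consists of the
series with `x_0 = x_3 = 0` and `c x_6 + x_l = 0` (`semigroupRing.mem_fam_iff`), so different `c`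
give different ideals. Hence Ulrich ideals exist, and there are infinitely many if `k` is infinite.

*Finiteness.* Let `I` be Ulrich with reduction `(f)`, let `v ∈ I` be a further minimal generator.
Freeness of `I / I ^ 2` gives: if `x v ∈ (f)` then `x ∈ I` (`mem_of_mul_mem_span_sup_sq`). As `f`
has the least order of all elements of `I`, this applies to every `x` in the conductor of `A`. So
every Ulrich ideal contains the conductor (`semigroupRing.orderIdeal_le_of_isUlrichIdeal`), and
over a finite field there are only finitely many such ideals.

*Monomial ideals.* The condition in the third claim says that `l` is odd. If `l = 2 q`, then
`(t ^ l, t ^ (3 q))` is Ulrich (`semigroupRing.isUlrichIdeal_mono`). Conversely, for a monomial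
Ulrich ideal the conditions above become conditions on the set of exponents of its monomials,
which is determined by its least elements in the three residue classes modulo `3`; comparing these
shows that `l` is even (`even_of_exponents`).
-/

/-! ### Freeness of the conormal module -/

open IsLocalRing in
/-- An element of `I` all of whose coordinates in `I / I ^ 2` are non-units lies in `𝔪 I`. -/
theorem mem_maximalIdeal_mul_of_repr_not_isUnit {A : Type*} [CommRing A] [IsLocalRing A]
    {I : Ideal A} (hI : I ≤ maximalIdeal A) {ι : Type*} (b : Module.Basis ι (A ⧸ I) I.Cotangent)
    (w : I) (hw : ∀ s, ¬ IsUnit (b.repr (I.toCotangent w) s)) :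
    (w : A) ∈ maximalIdeal A * I := by
  choose c hc using fun s => Ideal.Quotient.mk_surjective (b.repr (I.toCotangent w) s)
  choose e he using fun s => I.toCotangent_surjective (b s)
  have hcm : ∀ s, c s ∈ maximalIdeal A := by
    intro s
    by_contra h
    apply hw s
    rw [← hc s]
    exact (by simpa using h : IsUnit (c s)).map _
  set z : I := ∑ s ∈ (b.repr (I.toCotangent w)).support, c s • e s with hz
  have h1 : I.toCotangent w = I.toCotangent z := by
    rw [hz, map_sum]
    conv_lhs => rw [← b.linearCombination_repr (I.toCotangent w)]
    rw [Finsupp.linearCombination_apply, Finsupp.sum]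
    refine Finset.sum_congr rfl fun s _ => ?_
    rw [map_smul, he, ← hc s]
    rfl
  have h2 : (z : A) ∈ maximalIdeal A * I := by
    rw [hz, AddSubmonoidClass.coe_finsetSum]
    exact Ideal.sum_mem _ fun s _ => Ideal.mul_mem_mul (hcm s) (e s).2
  have h3 := (I.toCotangent_eq).1 h1
  rw [pow_two] at h3
  have := Ideal.add_mem _ (Ideal.mul_mono_left hI h3) h2
  simpa using this

open IsLocalRing in
/-- Suppose that `I / I ^ 2` is free over `A / I`. If `u, v ∈ I` are such that `u ∉ 𝔪 I` and
`v ∉ (u) + 𝔪 I`, then some `2 × 2` minor of the coordinates of `u` and `v` is a unit, so a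
relation `x v ∈ (u) + I ^ 2` forces `x ∈ I`. -/
theorem mem_of_mul_mem_span_sup_sq {A : Type*} [CommRing A] [IsLocalRing A] {I : Ideal A}
    (hI : I ≤ maximalIdeal A) [Module.Free (A ⧸ I) I.Cotangent] {u v x : A} (hu : u ∈ I)
    (hv : v ∈ I) (hu' : u ∉ maximalIdeal A * I)
    (hv' : v ∉ Ideal.span {u} ⊔ maximalIdeal A * I)
    (hx : x * v ∈ Ideal.span {u} ⊔ I ^ 2) : x ∈ I := by
  let b := Module.Free.chooseBasis (A ⧸ I) I.Cotangent
  have key := mem_maximalIdeal_mul_of_repr_not_isUnit hI b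
  obtain ⟨s, hs⟩ : ∃ s, IsUnit (b.repr (I.toCotangent ⟨u, hu⟩) s) := by
    by_contra! h
    exact hu' (key ⟨u, hu⟩ h)
  obtain ⟨r, hr⟩ := Ideal.Quotient.mk_surjective
    (b.repr (I.toCotangent ⟨v, hv⟩) s * ((hs.unit⁻¹ : (A ⧸ I)ˣ) : A ⧸ I))
  -- Clear the `s`-th coordinate of `v`; what is left still lies outside `𝔪 I`.
  set v' : I := ⟨v, hv⟩ - r • ⟨u, hu⟩ with hv'def
  have hsm : ∀ (a : A) (y : I) i, b.repr (I.toCotangent (a • y)) i =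
      Ideal.Quotient.mk I a * b.repr (I.toCotangent y) i := by
    intro a y i
    rw [map_smul]
    have : a • I.toCotangent y = (Ideal.Quotient.mk I a) • I.toCotangent y := rfl
    rw [this, map_smul]
    rfl
  have hv's : b.repr (I.toCotangent v') s = 0 := by
    rw [hv'def, map_sub, map_sub, Finsupp.sub_apply, hsm, hr, mul_assoc, IsUnit.val_inv_mul,
      mul_one, sub_self]
  obtain ⟨t, ht⟩ : ∃ t, IsUnit (b.repr (I.toCotangent v') t) := by
    by_contra! h
    apply hv'
    have h1 := key v' h
    have : v = r * u + (v' : A) := by simp [hv'def]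
    rw [this]
    exact Ideal.add_mem _ (Ideal.mem_sup_left (Ideal.mul_mem_left _ _
      (Ideal.mem_span_singleton_self u))) (Ideal.mem_sup_right h1)
  obtain ⟨p, hp, q, hq, hpq⟩ := Submodule.mem_sup.1 hx
  obtain ⟨y, rfl⟩ := Ideal.mem_span_singleton'.1 hp
  have h1 : I.toCotangent (x • v') = I.toCotangent ((y - x * r) • (⟨u, hu⟩ : I)) := by
    rw [I.toCotangent_eq]
    have : ((x • v' : I) : A) - (((y - x * r) • (⟨u, hu⟩ : I) : I) : A) = q := by
      simp only [hv'def, smul_sub, smul_eq_mul, AddSubgroupClass.coe_sub, SetLike.val_smul]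
      linear_combination -hpq
    rw [this]
    exact hq
  have h2 : ∀ i, Ideal.Quotient.mk I x * b.repr (I.toCotangent v') i =
      Ideal.Quotient.mk I (y - x * r) * b.repr (I.toCotangent ⟨u, hu⟩) i := by
    intro i
    rw [← hsm, ← hsm, h1]
  have h3 : Ideal.Quotient.mk I (y - x * r) = 0 := by
    have := h2 s
    rw [hv's, mul_zero] at this
    exact hs.mul_left_eq_zero.1 this.symm
  have h4 := h2 t
  rw [h3, zero_mul] at h4
  exact Ideal.Quotient.eq_zero_iff_mem.1 (ht.mul_left_eq_zero.1 h4)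

theorem span_pair_sq_eq {A : Type*} [CommRing A] {f g : A}
    (hg : g ^ 2 ∈ Ideal.span {f} * Ideal.span {f, g}) :
    Ideal.span {f, g} ^ 2 = Ideal.span {f} * Ideal.span {f, g} := by
  have hf : f ∈ Ideal.span {f, g} := Ideal.subset_span (by simp)
  have hg' : g ∈ Ideal.span {f, g} := Ideal.subset_span (by simp)
  have hff := Ideal.mem_span_singleton_self f
  apply le_antisymm
  · rw [pow_two, Ideal.span_mul_span', Ideal.span_le]
    rintro _ ⟨a, ha, b, hb, rfl⟩
    simp only [Set.mem_insert_iff, Set.mem_singleton_iff] at ha hb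
    show a * b ∈ _
    rcases ha with ha | ha <;> rcases hb with hb | hb <;> rw [ha, hb]
    · exact Ideal.mul_mem_mul hff hf
    · exact Ideal.mul_mem_mul hff hg'
    · rw [mul_comm g f]
      exact Ideal.mul_mem_mul hff hg'
    · rwa [← pow_two]
  · rw [pow_two]
    exact Ideal.mul_mono_left (by rwa [Ideal.span_singleton_le_iff_mem])

theorem free_cotangent_span_pair {A : Type*} [CommRing A] [IsDomain A] {f g : A} (hf : f ≠ 0)
    (hg : g ^ 2 ∈ Ideal.span {f} * Ideal.span {f, g})
    (hcolon : ∀ x, f ∣ x * g → x ∈ Ideal.span {f, g}) :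
    Module.Free (A ⧸ Ideal.span {f, g}) (Ideal.span {f, g}).Cotangent := by
  have hsq := span_pair_sq_eq hg
  set I := Ideal.span {f, g} with hI
  have hfI : f ∈ I := Ideal.subset_span (by simp)
  have hgI : g ∈ I := Ideal.subset_span (by simp)
  have hsmul : ∀ (a : A) (y : I), Ideal.Quotient.mk I a • I.toCotangent y =
      I.toCotangent (a • y) := fun a y => (map_smul I.toCotangent a y).symm
  have hli : LinearIndependent (A ⧸ I) ![I.toCotangent ⟨f, hfI⟩, I.toCotangent ⟨g, hgI⟩] := by
    rw [LinearIndependent.pair_iff]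
    intro s t hst
    obtain ⟨a, rfl⟩ := Ideal.Quotient.mk_surjective s
    obtain ⟨b, rfl⟩ := Ideal.Quotient.mk_surjective t
    rw [hsmul, hsmul, ← map_add, I.toCotangent_eq_zero] at hst
    simp only [Submodule.coe_add, SetLike.val_smul, smul_eq_mul, hsq] at hst
    obtain ⟨z, hz, hz'⟩ := Ideal.mem_span_singleton_mul.1 hst
    have hb : b ∈ I := hcolon b ⟨z - a, by linear_combination -hz'⟩
    have hbg : b * g ∈ I ^ 2 := by rw [pow_two]; exact Ideal.mul_mem_mul hb hgI
    rw [hsq] at hbg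
    obtain ⟨w, hw, hw'⟩ := Ideal.mem_span_singleton_mul.1 hbg
    have ha : a = z - w := mul_left_cancel₀ hf (by linear_combination -hz' + hw')
    exact ⟨Ideal.Quotient.eq_zero_iff_mem.2 (ha ▸ I.sub_mem hz hw),
      Ideal.Quotient.eq_zero_iff_mem.2 hb⟩
  refine Module.Free.of_basis (Module.Basis.mk hli ?_)
  rintro c -
  obtain ⟨⟨y, hy⟩, rfl⟩ := I.toCotangent_surjective c
  obtain ⟨a, b, hab⟩ := Ideal.mem_span_pair.1 hy
  have : (⟨y, hy⟩ : I) = a • ⟨f, hfI⟩ + b • ⟨g, hgI⟩ := Subtype.ext hab.symm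
  rw [this, map_add, ← hsmul, ← hsmul]
  exact Submodule.add_mem _ (Submodule.smul_mem _ _ (Submodule.subset_span ⟨0, rfl⟩))
    (Submodule.smul_mem _ _ (Submodule.subset_span ⟨1, rfl⟩))

/-! ### Exponents of a monomial Ulrich ideal -/

theorem mod_three_cases {l : ℕ} (hl : l % 3 ≠ 0) (a n : ℕ) :
    n % 3 = a % 3 ∨ n % 3 = (a + l) % 3 ∨ n % 3 = (a + 2 * l) % 3 := by
  obtain h1 | h1 : l % 3 = 1 ∨ l % 3 = 2 := by omega
  all_goals obtain h2 | h2 | h2 : a % 3 = 0 ∨ a % 3 = 1 ∨ a % 3 = 2 := by omega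
  all_goals omega

/-- The numerical part of the classification of monomial Ulrich ideals. Here `H` is the semigroup
`⟨3, l⟩`, and `E` is the set of exponents of the monomials in the ideal, with minimum `a`. The
hypothesis `hmul` says `I ^ 2 ⊆ t ^ a I`, `hfree` is the consequence of freeness of `I / I ^ 2`
for the minimal generators `t ^ a, t ^ v`, and `hne` says that `I` is not principal.
As an `H`-module, `E` is determined by its least elements `a`, `P`, `R` in the residue classes of
`a`, `a + l`, `a + 2 l` modulo `3`. Freeness bounds these from above in terms of the differences
`P - a` and `R - a`, the other conditions bound them from below, and the bounds are compatible only
if `a = l`, `P = 2 l` and `2 R = 3 l`. -/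
theorem even_of_exponents {l a : ℕ} (hl : l % 3 ≠ 0) {H E : ℕ → Prop}
    (hH : ∀ n, H n ↔ n % 3 = 0 ∨ (n % 3 = l % 3 ∧ l ≤ n) ∨ (n % 3 = (2 * l) % 3 ∧ 2 * l ≤ n))
    (hEH : ∀ n, E n → H n) (hadd : ∀ h e, H h → E e → E (h + e)) (ha : E a) (ha0 : 0 < a)
    (hmin : ∀ e, E e → a ≤ e)
    (hmul : ∀ e e', E e → E e' → ∃ i, E i ∧ e + e' = a + i)
    (hfree : ∀ v, E v → (∀ h, H h → v ≠ h + a) → (∀ h e, H h → 0 < h → E e → v ≠ h + e) →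
      ∀ x h, H x → H h → x + v = h + a → E x)
    (hne : ∃ e, E e ∧ ∀ h, H h → e ≠ h + a) : Even l := by
  classical
  have hal : ∃ n, E n ∧ n % 3 = (a + l) % 3 :=
    ⟨l + a, hadd l a ((hH l).2 (by omega)) ha, by omega⟩
  have ha2l : ∃ n, E n ∧ n % 3 = (a + 2 * l) % 3 :=
    ⟨2 * l + a, hadd (2 * l) a ((hH _).2 (by omega)) ha, by omega⟩
  obtain ⟨P, hP, hPmin⟩ : ∃ P, (E P ∧ P % 3 = (a + l) % 3) ∧
      ∀ n, E n → n % 3 = (a + l) % 3 → P ≤ n :=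
    ⟨Nat.find hal, Nat.find_spec hal, fun n h h' => Nat.find_min' hal ⟨h, h'⟩⟩
  obtain ⟨R, hR, hRmin⟩ : ∃ R, (E R ∧ R % 3 = (a + 2 * l) % 3) ∧
      ∀ n, E n → n % 3 = (a + 2 * l) % 3 → R ≤ n :=
    ⟨Nat.find ha2l, Nat.find_spec ha2l, fun n h h' => Nat.find_min' ha2l ⟨h, h'⟩⟩
  obtain ⟨hPE, hPc⟩ := hP
  obtain ⟨hRE, hRc⟩ := hR
  have hshift : ∀ m n, E m → m ≤ n → n % 3 = m % 3 → E n := by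
    intro m n hm hmn h3
    have := hadd (n - m) m ((hH _).2 (by omega)) hm
    rwa [Nat.sub_add_cancel hmn] at this
  have hE : ∀ n, E n ↔ (n % 3 = a % 3 ∧ a ≤ n) ∨ (n % 3 = (a + l) % 3 ∧ P ≤ n) ∨
      (n % 3 = (a + 2 * l) % 3 ∧ R ≤ n) := by
    intro n
    constructor
    · intro h
      rcases mod_three_cases hl a n with hc | hc | hc
      · exact Or.inl ⟨hc, hmin n h⟩
      · exact Or.inr (Or.inl ⟨hc, hPmin n h hc⟩)
      · exact Or.inr (Or.inr ⟨hc, hRmin n h hc⟩)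
    · rintro (h | h | h)
      · exact hshift a n ha h.2 h.1
      · exact hshift P n hPE h.2 (h.1.trans hPc.symm)
      · exact hshift R n hRE h.2 (h.1.trans hRc.symm)
  have b1 : ∀ n, E n → n % 3 = l % 3 → l ≤ n := by
    intro n hn h
    have := (hH n).1 (hEH n hn)
    clear hal ha2l hPc hRc
    omega
  have b2 : ∀ n, E n → n % 3 = (2 * l) % 3 → 2 * l ≤ n := by
    intro n hn h
    have := (hH n).1 (hEH n hn)
    clear hal ha2l hPc hRc
    omega
  clear hal ha2l
  have hPle : P ≤ a + l :=
    hPmin _ (by rw [add_comm]; exact hadd l a ((hH l).2 (by omega)) ha) rfl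
  have haP := hmin P hPE
  have haR := hmin R hRE
  rcases hPle.lt_or_eq with hlt | heq
  · -- If `t ^ P` is a minimal generator, the conditions are contradictory.
    exfalso
    have hf := hfree P hPE
      (by intro h hh; have := (hH h).1 hh; clear hRc haR; omega)
      (by
        intro h e hh h0 he hPhe
        have := (hH h).1 hh
        have hae := hmin e he
        have hl' : h < l := by omega
        have h3 : h % 3 = 0 := by omega
        have := hPmin e he (by omega)
        omega)
    have h1 := hf (a + l - P) l ((hH _).2 (by omega)) ((hH _).2 (by omega)) (by omega)
    have h2 := hf (2 * l + a - P) (2 * l) ((hH _).2 (by omega)) ((hH _).2 (by omega)) (by omega)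
    have h3 := hf (2 * l) (2 * l + P - a) ((hH _).2 (by omega)) ((hH _).2 (by omega)) (by omega)
    obtain ⟨i, hi, hi'⟩ := hmul _ _ h1 hRE
    obtain ⟨j, hj, hj'⟩ := hmul _ _ hPE hPE
    have hi2 := b2 i hi (by omega)
    have hRle : R ≤ P + l := by
      refine hRmin _ ?_ (by omega)
      rw [add_comm]; exact hadd l P ((hH l).2 (by omega)) hPE
    have hR : R = P + l := by omega
    have hc : a % 3 = 0 ∨ a % 3 = l % 3 ∨ a % 3 = (2 * l) % 3 := by
      simpa using mod_three_cases hl 0 a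
    rcases hc with hc | hc | hc
    · have := hmin _ h1
      have := b2 j hj (by omega)
      omega
    · have := b2 P hPE (by omega)
      have := hmin _ h2
      have := hRmin _ h1 (by omega)
      omega
    · have := b2 a ha hc
      have := hPmin _ h1 (by omega)
      have := hmin _ h3
      omega
  · -- Otherwise `t ^ R` is one, since the ideal is not principal.
    have hlt : R < a + 2 * l := by
      obtain ⟨e, he, he'⟩ := hne
      have h2 := he' (e - a)
      have h3 := hmin e he
      rw [hH] at h2
      rcases (hE e).1 he with h1 | h1 | h1 <;> omega
    have hf := hfree R hRE
      (by intro h hh; have := (hH h).1 hh; clear hPc; omega)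
      (by
        intro h e hh h0 he hRhe
        have hae := hmin e he
        rcases (hH h).1 hh with h3 | h3 | h3
        · have := hRmin e he (by omega)
          omega
        · have := hPmin e he (by omega)
          omega
        · omega)
    have h1 := hf (a + 2 * l - R) (2 * l) ((hH _).2 (by omega)) ((hH _).2 (by omega)) (by omega)
    have h2 := hf l (l + R - a) ((hH _).2 (by omega)) ((hH _).2 (by omega)) (by omega)
    obtain ⟨i, hi, hi'⟩ := hmul _ _ hRE hRE
    have hi2 := hPmin i hi (by omega)
    have h3 := hf (2 * l) (2 * l + R - a) ((hH _).2 (by omega)) ((hH _).2 (by omega)) (by omega)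
    have hc : a % 3 = 0 ∨ a % 3 = l % 3 ∨ a % 3 = (2 * l) % 3 := by
      simpa using mod_three_cases hl 0 a
    rw [Nat.even_iff]
    rcases hc with hc | hc | hc
    · have := hPmin _ h2 (by omega)
      omega
    · have := b1 a ha hc
      have := hmin _ h2
      have := hRmin _ h1 (by omega)
      omega
    · have := b2 a ha hc
      have := hmin _ h3
      have := hPmin _ h1 (by omega)
      omega

namespace semigroupRing

open IsLocalRing PowerSeries

/-! ### Semigroup rings of numerical semigroups and their Ulrich ideals -/

variable {k : Type*} [Field k] {H : AddSubmonoid ℕ}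

/-- The monomial `t ^ n` as an element of `k[[H]]`, for `n ∈ H`. -/
noncomputable def mono (k : Type*) [Field k] {H : AddSubmonoid ℕ} (n : ℕ) (hn : n ∈ H) :
    semigroupRing k H :=
  ⟨X ^ n, fun m hm => by
    rw [coeff_X_pow] at hm
    split_ifs at hm with h
    · rwa [h]
    · exact absurd rfl hm⟩

@[simp]
theorem coe_mono (n : ℕ) (hn : n ∈ H) : ((mono k n hn : semigroupRing k H) : k⟦X⟧) = X ^ n := rfl

theorem mono_ne_zero (n : ℕ) (hn : n ∈ H) : mono k n hn ≠ 0 := fun h =>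
  pow_ne_zero n (X_ne_zero (R := k)) (congrArg Subtype.val h)

theorem coe_ne_zero {x : semigroupRing k H} (hx : x ≠ 0) : (x : k⟦X⟧) ≠ 0 := fun h =>
  hx (Subtype.ext h)

theorem coeff_eq_zero (x : semigroupRing k H) {n : ℕ} (hn : n ∉ H) : coeff n (x : k⟦X⟧) = 0 := by
  by_contra h
  exact hn (x.2 n h)

theorem mem_maximalIdeal {x : semigroupRing k H} :
    x ∈ maximalIdeal (semigroupRing k H) ↔ coeff 0 (x : k⟦X⟧) = 0 := by
  rw [IsLocalRing.mem_maximalIdeal, mem_nonunits_iff, coeff_zero_eq_constantCoeff_apply]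
  constructor
  · intro h
    by_contra h0
    exact h (isUnit_semigroupRing x h0)
  · rintro h hu
    have := (hu.map (semigroupRing k H).val).map (constantCoeff (R := k))
    exact this.ne_zero h

/-- The ideal of all elements of `k[[H]]` of order at least `n` in `t`. -/
noncomputable def orderIdeal (k : Type*) [Field k] (H : AddSubmonoid ℕ) (n : ℕ) :
    Ideal (semigroupRing k H) :=
  (Ideal.span {(X : k⟦X⟧) ^ n}).comap (semigroupRing k H).val

theorem mem_orderIdeal {n : ℕ} {x : semigroupRing k H} :
    x ∈ orderIdeal k H n ↔ (X : k⟦X⟧) ^ n ∣ (x : k⟦X⟧) := by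
  rw [orderIdeal, Ideal.mem_comap, Ideal.mem_span_singleton]
  rfl

theorem mem_orderIdeal_iff_coeff {n : ℕ} {x : semigroupRing k H} :
    x ∈ orderIdeal k H n ↔ ∀ m < n, coeff m (x : k⟦X⟧) = 0 := by
  rw [mem_orderIdeal, X_pow_dvd_iff]

theorem maximalIdeal_eq_orderIdeal : maximalIdeal (semigroupRing k H) = orderIdeal k H 1 := by
  ext x
  rw [mem_maximalIdeal, mem_orderIdeal_iff_coeff]
  simp

theorem orderIdeal_mul_le (m n : ℕ) :
    orderIdeal k H m * orderIdeal k H n ≤ orderIdeal k H (m + n) := by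
  rw [Ideal.mul_le]
  intro x hx y hy
  rw [mem_orderIdeal] at *
  rw [pow_add]
  exact mul_dvd_mul hx hy

theorem maximalIdeal_pow_le (n : ℕ) : maximalIdeal (semigroupRing k H) ^ n ≤ orderIdeal k H n := by
  induction n with
  | zero => intro x _; simp [mem_orderIdeal]
  | succ n ih =>
    rw [pow_succ]
    refine le_trans (Ideal.mul_mono ih ?_) (orderIdeal_mul_le n 1)
    rw [maximalIdeal_eq_orderIdeal]

/-- If every integer `≥ N` lies in `H`, then a nonzero `f` divides every element of sufficiently
large order: the quotient in `k[[t]]` has order `≥ N`, so all its exponents lie in `H`. -/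
theorem orderIdeal_le_span {N : ℕ} (hN : ∀ n, N ≤ n → n ∈ H) {f : semigroupRing k H} (hf : f ≠ 0) :
    orderIdeal k H ((f : k⟦X⟧).order.toNat + N) ≤ Ideal.span {f} := by
  intro x hx
  rw [mem_orderIdeal] at hx
  obtain ⟨z, hz⟩ := hx
  have hf' := coe_ne_zero hf
  have hu : constantCoeff (divXPowOrder (f : k⟦X⟧)) ≠ 0 := by
    rwa [Ne, constantCoeff_divXPowOrder_eq_zero_iff]
  refine Ideal.mem_span_singleton.2
    ⟨⟨X ^ N * (z * (divXPowOrder (f : k⟦X⟧))⁻¹), fun n hn => hN n ?_⟩, Subtype.ext ?_⟩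
  · by_contra h
    rw [coeff_X_pow_mul', if_neg h] at hn
    exact hn rfl
  · show (x : k⟦X⟧) = (f : k⟦X⟧) * (X ^ N * (z * (divXPowOrder (f : k⟦X⟧))⁻¹))
    have h1 := X_pow_order_mul_divXPowOrder (f := (f : k⟦X⟧))
    have h2 := PowerSeries.mul_inv_cancel _ hu
    calc (x : k⟦X⟧) = X ^ (f : k⟦X⟧).order.toNat * X ^ N * z *
          (divXPowOrder (f : k⟦X⟧) * (divXPowOrder (f : k⟦X⟧))⁻¹) := by
            rw [h2, mul_one, hz, pow_add]
      _ = (X ^ (f : k⟦X⟧).order.toNat * divXPowOrder (f : k⟦X⟧)) * (X ^ N *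
          (z * (divXPowOrder (f : k⟦X⟧))⁻¹)) := by ring
      _ = _ := by rw [h1]

theorem radical_eq_maximalIdeal {N : ℕ} (hN : ∀ n, N ≤ n → n ∈ H) {I : Ideal (semigroupRing k H)}
    {f : semigroupRing k H} (hf : f ≠ 0) (hfI : f ∈ I) (hI : I ≤ maximalIdeal _) :
    I.radical = maximalIdeal (semigroupRing k H) := by
  refine le_antisymm ((Ideal.IsPrime.radical_le_iff inferInstance).2 hI) fun x hx => ?_
  refine ⟨(f : k⟦X⟧).order.toNat + N, ?_⟩
  have h1 := orderIdeal_le_span hN hf (maximalIdeal_pow_le _ (Ideal.pow_mem_pow hx _))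
  exact (Ideal.span_singleton_le_iff_mem I).2 hfI h1

theorem mono_mem_maximalIdeal {n : ℕ} (hn : n ∈ H) (h : 0 < n) :
    mono k n hn ∈ maximalIdeal (semigroupRing k H) := by
  rw [mem_maximalIdeal, coe_mono, coeff_X_pow, if_neg h.ne]

theorem ringKrullDim_eq_one {N : ℕ} (hN : ∀ n, N ≤ n → n ∈ H) :
    ringKrullDim (semigroupRing k H) = 1 := by
  have hdim : Ring.KrullDimLE 1 (semigroupRing k H) := by
    refine Ring.krullDimLE_one_iff_of_noZeroDivisors.2 fun p hp hpp => ?_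
    obtain ⟨f, hf, hf0⟩ := Submodule.exists_mem_ne_zero_of_ne_bot hp
    have h := radical_eq_maximalIdeal hN hf0 hf (le_maximalIdeal hpp.ne_top)
    rw [hpp.radical] at h
    rw [h]
    infer_instance
  apply eq_of_le_of_not_lt ?_ fun h' => ?_
  · have hle : Ring.KrullDimLE 1 (semigroupRing k H) := hdim
    rw [← Nat.cast_one, ← Ring.krullDimLE_iff]
    exact hle
  · have h'' : ringKrullDim (semigroupRing k H) ≤ 0 := Order.le_of_lt_succ h'
    rw [← Nat.cast_zero, ← Ring.krullDimLE_iff] at h''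
    have hfield := Ring.KrullDimLE.isField_of_isDomain (R := semigroupRing k H)
    rw [isField_iff_maximalIdeal_eq] at hfield
    have := mono_mem_maximalIdeal (k := k) (hN (N + 1) (by omega)) (by omega)
    rw [hfield] at this
    exact mono_ne_zero _ _ this

/-- As `k[[H]]` has dimension one, its parameter ideals are the proper nonzero principal ideals. -/
theorem isParameterIdeal_iff {N : ℕ} (hN : ∀ n, N ≤ n → n ∈ H) {Q : Ideal (semigroupRing k H)} :
    IsParameterIdeal Q ↔ ∃ f, f ≠ 0 ∧ f ∈ maximalIdeal (semigroupRing k H) ∧ Q = Ideal.span {f} := by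
  rw [IsParameterIdeal, ringKrullDim_eq_one hN]
  constructor
  · rintro ⟨hrad, s, hs, rfl⟩
    have hs1 : s.card = 1 := by exact_mod_cast hs
    obtain ⟨f, rfl⟩ := Finset.card_eq_one.1 hs1
    rw [Finset.coe_singleton] at hrad ⊢
    refine ⟨f, ?_, ?_, rfl⟩
    · rintro rfl
      have := mono_mem_maximalIdeal (k := k) (hN (N + 1) (by omega)) (by omega)
      rw [← hrad] at this
      obtain ⟨n, hn⟩ := this
      rw [Ideal.mem_span_singleton, zero_dvd_iff] at hn
      exact mono_ne_zero _ _ (eq_zero_of_pow_eq_zero hn)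
    · rw [← hrad]
      exact Ideal.le_radical (Ideal.mem_span_singleton_self f)
  · rintro ⟨f, hf, hfm, rfl⟩
    refine ⟨radical_eq_maximalIdeal hN hf (Ideal.mem_span_singleton_self f)
      (by rwa [Ideal.span_singleton_le_iff_mem]), {f}, by simp, by simp⟩

/-- A two-generated ideal `(f, g)` with `g ^ 2 ∈ f (f, g)` and `(f) : g ⊆ (f, g)` is an
Ulrich ideal: `f` and `g` give a basis of `I / I ^ 2` over `A / I`. -/
theorem isUlrichIdeal_span_pair {N : ℕ} (hN : ∀ n, N ≤ n → n ∈ H) {f g : semigroupRing k H}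
    (hf : f ≠ 0) (hfm : f ∈ maximalIdeal (semigroupRing k H))
    (hgm : g ∈ maximalIdeal (semigroupRing k H))
    (hg : g ^ 2 ∈ Ideal.span {f} * Ideal.span {f, g})
    (hcolon : ∀ x, f ∣ x * g → x ∈ Ideal.span {f, g}) :
    IsUlrichIdeal (Ideal.span {f, g}) := by
  have hfI : f ∈ Ideal.span {f, g} := Ideal.subset_span (by simp)
  have hle : Ideal.span {f, g} ≤ maximalIdeal (semigroupRing k H) := by
    rw [Ideal.span_le]
    rintro x (rfl | rfl)
    · exact hfm
    · exact hgm
  refine ⟨radical_eq_maximalIdeal hN hf hfI hle, ⟨Ideal.span {f},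
    (isParameterIdeal_iff hN).2 ⟨f, hf, hfm, rfl⟩, ?_, ?_, span_pair_sq_eq hg⟩,
    free_cotangent_span_pair hf hg hcolon⟩
  · rwa [Ideal.span_singleton_le_iff_mem]
  · intro h
    have hfg : f ∣ 1 * g := by
      rw [one_mul, ← Ideal.mem_span_singleton, ← h]
      exact Ideal.subset_span (by simp)
    exact (Ideal.ne_top_iff_one _).1 (Ideal.IsPrime.ne_top inferInstance) (hle (hcolon 1 hfg))

/-- The part of the definition of an Ulrich ideal concerning the reduction, in terms of a
generator of the parameter ideal. -/
theorem exists_reduction {N : ℕ} (hN : ∀ n, N ≤ n → n ∈ H) {I : Ideal (semigroupRing k H)}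
    (hI : IsUlrichIdeal I) : ∃ f ∈ I, f ≠ 0 ∧ I ≠ Ideal.span {f} ∧ I ^ 2 = Ideal.span {f} * I := by
  obtain ⟨-, ⟨Q, hQ, hQI, hne, hsq⟩, -⟩ := hI
  obtain ⟨f, hf, -, rfl⟩ := (isParameterIdeal_iff hN).1 hQ
  exact ⟨f, hQI (Ideal.mem_span_singleton_self f), hf, hne, hsq⟩

/-- A generator of a principal reduction has minimal order: for `g ∈ I` of minimal order,
`g ^ 2 = f i` with `i ∈ I` forces `2 ord g ≥ ord f + ord g`. -/
theorem order_le_of_sq_eq {I : Ideal (semigroupRing k H)} {f : semigroupRing k H} (hfI : f ∈ I)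
    (hf : f ≠ 0) (hsq : I ^ 2 = Ideal.span {f} * I) {x : semigroupRing k H} (hx : x ∈ I) :
    (f : k⟦X⟧).order ≤ (x : k⟦X⟧).order := by
  obtain ⟨g, hg, hmin⟩ := exists_minimalFor_of_wellFoundedLT (· ∈ I)
    (fun y : semigroupRing k H => (y : k⟦X⟧).order) ⟨f, hfI⟩
  have hmin' : ∀ y ∈ I, (g : k⟦X⟧).order ≤ (y : k⟦X⟧).order := fun y hy =>
    (le_total _ _).elim id fun h => hmin hy h
  refine le_trans ?_ (hmin' x hx)
  have hgg : g ^ 2 ∈ Ideal.span {f} * I := hsq ▸ Ideal.pow_mem_pow hg 2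
  obtain ⟨i, hi, hgi⟩ := Ideal.mem_span_singleton_mul.1 hgg
  have h1 : (f : k⟦X⟧) * (i : k⟦X⟧) = (g : k⟦X⟧) * (g : k⟦X⟧) := by
    rw [← pow_two]
    exact congrArg Subtype.val hgi
  have h2 := congrArg order h1
  rw [order_mul, order_mul] at h2
  have hfin : (g : k⟦X⟧).order ≠ ⊤ := by
    have := order_finite_iff_ne_zero.2 (coe_ne_zero hf)
    exact ((hmin' f hfI).trans_lt this).ne
  have h3 : (f : k⟦X⟧).order + (g : k⟦X⟧).order ≤ (g : k⟦X⟧).order + (g : k⟦X⟧).order := by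
    rw [← h2]
    gcongr
    exact hmin' i hi
  exact (ENat.add_le_add_iff_right hfin).1 h3

theorem notMem_maximalIdeal_mul {I : Ideal (semigroupRing k H)} {f : semigroupRing k H}
    (hf : f ≠ 0) (hmin : ∀ x ∈ I, (f : k⟦X⟧).order ≤ (x : k⟦X⟧).order) :
    f ∉ maximalIdeal (semigroupRing k H) * I := by
  intro h
  have h1 : I ≤ orderIdeal k H (f : k⟦X⟧).order.toNat := by
    intro x hx
    rw [mem_orderIdeal_iff_coeff]
    intro m hm
    apply coeff_of_lt_order
    refine lt_of_lt_of_le ?_ (hmin x hx)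
    rw [← coe_toNat_order (coe_ne_zero hf)]
    exact_mod_cast hm
  have h2 := (Ideal.mul_mono maximalIdeal_eq_orderIdeal.le h1).trans (orderIdeal_mul_le _ _) h
  rw [mem_orderIdeal_iff_coeff] at h2
  exact coeff_order (coe_ne_zero hf) (h2 _ (by omega))

/-- Nakayama's lemma modulo a nonzero principal ideal, which contains a power of the maximal
ideal; no finiteness of `I` is needed. -/
theorem exists_notMem_span_sup {N : ℕ} (hN : ∀ n, N ≤ n → n ∈ H) {I : Ideal (semigroupRing k H)}
    {f : semigroupRing k H} (hf : f ≠ 0) (hfI : f ∈ I) (hne : I ≠ Ideal.span {f}) :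
    ∃ v ∈ I, v ∉ Ideal.span {f} ⊔ maximalIdeal (semigroupRing k H) * I := by
  by_contra! hcon
  have hcon' : I ≤ Ideal.span {f} ⊔ maximalIdeal (semigroupRing k H) * I := hcon
  have key : ∀ n, I ≤ Ideal.span {f} ⊔ maximalIdeal (semigroupRing k H) ^ n * I := by
    intro n
    induction n with
    | zero => simp
    | succ n ih =>
      refine ih.trans (sup_le le_sup_left ((Ideal.mul_mono_right hcon').trans ?_))
      rw [Ideal.mul_sup, ← mul_assoc, ← pow_succ]
      exact sup_le_sup_right Ideal.mul_le_right _
  apply hne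
  refine le_antisymm ((key ((f : k⟦X⟧).order.toNat + N)).trans (sup_le le_rfl ?_))
    (by rwa [Ideal.span_singleton_le_iff_mem])
  exact Ideal.mul_le_left.trans ((maximalIdeal_pow_le _).trans (orderIdeal_le_span hN hf))

/-- Every Ulrich ideal of `k[[H]]` contains the conductor: if `x` has order at least the
conductor and `v ∈ I`, then `f ∣ x v`, since `ord v ≥ ord f`. -/
theorem orderIdeal_le_of_isUlrichIdeal {N : ℕ} (hN : ∀ n, N ≤ n → n ∈ H)
    {I : Ideal (semigroupRing k H)} (hI : IsUlrichIdeal I) : orderIdeal k H N ≤ I := by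
  obtain ⟨f, hfI, hf, hne, hsq⟩ := exists_reduction hN hI
  have hmin := fun x (hx : x ∈ I) => order_le_of_sq_eq hfI hf hsq hx
  obtain ⟨v, hv, hv'⟩ := exists_notMem_span_sup hN hf hfI hne
  have := hI.2.2
  intro x hx
  refine mem_of_mul_mem_span_sup_sq (hI.1 ▸ Ideal.le_radical) hfI hv
    (notMem_maximalIdeal_mul hf hmin) hv' (Ideal.mem_sup_left ?_)
  apply orderIdeal_le_span hN hf
  rw [add_comm]
  refine orderIdeal_mul_le _ _ (Ideal.mul_mem_mul hx ?_)
  rw [mem_orderIdeal_iff_coeff]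
  intro m hm
  apply coeff_of_lt_order
  refine lt_of_lt_of_le ?_ (hmin v hv)
  rw [← coe_toNat_order (coe_ne_zero hf)]
  exact_mod_cast hm

/-- Over a finite field there are finitely many ideals containing the conductor: such an ideal is
determined by the coefficients below the conductor of its elements. -/
theorem finite_ulrichIdeals {N : ℕ} (hN : ∀ n, N ≤ n → n ∈ H) [Finite k] :
    (ulrichIdeals (semigroupRing k H)).Finite := by
  let φ : semigroupRing k H → Fin N → k := fun x i => coeff (i : ℕ) (x : k⟦X⟧)
  refine Set.Finite.of_finite_image
    (f := fun I : Ideal (semigroupRing k H) => φ '' (I : Set (semigroupRing k H)))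
    (Set.toFinite _) ?_
  have key : ∀ I J : Ideal (semigroupRing k H), orderIdeal k H N ≤ J →
      φ '' (I : Set (semigroupRing k H)) = φ '' (J : Set (semigroupRing k H)) → I ≤ J := by
    intro I J hJ h x hx
    obtain ⟨y, hy, hxy⟩ : φ x ∈ φ '' (J : Set (semigroupRing k H)) := h ▸ ⟨x, hx, rfl⟩
    have : x - y ∈ J := by
      apply hJ
      rw [mem_orderIdeal_iff_coeff]
      intro m hm
      have := congrFun hxy ⟨m, hm⟩
      simp only [φ] at this
      simp [this]
    simpa using J.add_mem this hy
  intro I hI J hJ h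
  exact le_antisymm (key I J (orderIdeal_le_of_isUlrichIdeal hN hJ) h)
    (key J I (orderIdeal_le_of_isUlrichIdeal hN hI) h.symm)

/-! ### Monomial generators and the semigroup `⟨3, l⟩` -/

/-- An ideal containing the monomials `t ^ e` for `e` in the finite set `s` contains every power
series all of whose exponents lie in `s + H`. -/
theorem mem_of_support {I : Ideal (semigroupRing k H)} (s : Finset ℕ)
    (hs : ∀ e ∈ s, ∃ y ∈ I, (y : k⟦X⟧) = X ^ e) {x : semigroupRing k H}
    (hx : ∀ n, coeff n (x : k⟦X⟧) ≠ 0 → ∃ e ∈ s, ∃ h ∈ H, n = h + e) : x ∈ I := by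
  classical
  induction s using Finset.induction_on generalizing x with
  | empty =>
    have : x = 0 := Subtype.ext (PowerSeries.ext fun n => by
      by_contra h
      obtain ⟨e, he, -⟩ := hx n h
      simp at he)
    rw [this]
    exact I.zero_mem
  | insert e s hes ih =>
    obtain ⟨y, hy, hye⟩ := hs e (by simp)
    let z : semigroupRing k H :=
      ⟨PowerSeries.mk fun m => if m ∈ H then coeff (m + e) (x : k⟦X⟧) else 0, fun m hm => by
        rw [coeff_mk] at hm
        by_contra h
        exact hm (if_neg h)⟩
    have hz : ∀ m, coeff m (z : k⟦X⟧) = if m ∈ H then coeff (m + e) (x : k⟦X⟧) else 0 :=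
      fun m => by
        show coeff m (PowerSeries.mk fun m => if m ∈ H then coeff (m + e) (x : k⟦X⟧) else 0) = _
        rw [coeff_mk]
    -- `t ^ e z` collects the terms of `x` with exponent in `e + H`.
    have h1 : x - y * z ∈ I := by
      apply ih fun e he => hs e (by simp [he])
      intro n hn
      have hn' : coeff n (x : k⟦X⟧) -
          (if e ≤ n then coeff (n - e) (z : k⟦X⟧) else 0) ≠ 0 := by
        rw [← coeff_X_pow_mul', ← hye]
        simpa using hn
      by_cases hen : e ≤ n
      · rw [if_pos hen, hz, Nat.sub_add_cancel hen] at hn'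
        by_cases hH : n - e ∈ H
        · rw [if_pos hH, sub_self] at hn'
          exact absurd rfl hn'
        · rw [if_neg hH, sub_zero] at hn'
          obtain ⟨e', he', h, hh, hnh⟩ := hx n hn'
          rcases Finset.mem_insert.1 he' with rfl | he'
          · exact absurd (by rwa [hnh, Nat.add_sub_cancel]) hH
          · exact ⟨e', he', h, hh, hnh⟩
      · rw [if_neg hen, sub_zero] at hn'
        obtain ⟨e', he', h, hh, hnh⟩ := hx n hn'
        rcases Finset.mem_insert.1 he' with rfl | he'
        · omega
        · exact ⟨e', he', h, hh, hnh⟩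
    have := I.add_mem h1 (I.mul_mem_right z hy)
    simpa using this

theorem mem_closure_three_iff {l : ℕ} (n : ℕ) :
    n ∈ AddSubmonoid.closure ({3, l} : Set ℕ) ↔
      n % 3 = 0 ∨ (n % 3 = l % 3 ∧ l ≤ n) ∨ (n % 3 = (2 * l) % 3 ∧ 2 * l ≤ n) := by
  rw [AddSubmonoid.mem_closure_pair]
  constructor
  · rintro ⟨a, b, rfl⟩
    simp only [smul_eq_mul]
    obtain ⟨c, r, hr, rfl⟩ : ∃ c r, r < 3 ∧ b = 3 * c + r :=
      ⟨b / 3, b % 3, Nat.mod_lt _ (by norm_num), (Nat.div_add_mod b 3).symm⟩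
    have : (3 * c + r) * l = 3 * (c * l) + r * l := by ring
    rw [this]
    generalize c * l = w
    interval_cases r <;> omega
  · simp only [smul_eq_mul]
    rintro (h | h | h)
    · exact ⟨n / 3, 0, by omega⟩
    · exact ⟨(n - l) / 3, 1, by omega⟩
    · exact ⟨(n - 2 * l) / 3, 2, by omega⟩

theorem mem_closure_three_of_le {l : ℕ} (hl : l % 3 ≠ 0) (n : ℕ) (hn : 2 * l ≤ n) :
    n ∈ AddSubmonoid.closure ({3, l} : Set ℕ) := by
  rw [mem_closure_three_iff]
  have := mod_three_cases hl 0 n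
  omega

theorem three_mem (l : ℕ) : 3 ∈ AddSubmonoid.closure ({3, l} : Set ℕ) :=
  AddSubmonoid.subset_closure (by simp)

theorem self_mem (l : ℕ) : l ∈ AddSubmonoid.closure ({3, l} : Set ℕ) :=
  AddSubmonoid.subset_closure (by simp)

/-! ### A one-parameter family of Ulrich ideals -/

section Family

variable {l : ℕ}

/-- The element `t ^ 6 - c t ^ l` of `k[[t ^ 3, t ^ l]]`. -/
noncomputable def famGen (l : ℕ) (c : k) : semigroupRing k (AddSubmonoid.closure {3, l}) :=
  mono k 3 (three_mem l) ^ 2 - algebraMap k _ c * mono k l (self_mem l)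

/-- The element `t ^ (l + 3)` of `k[[t ^ 3, t ^ l]]`. -/
noncomputable def famGen' (k : Type*) [Field k] (l : ℕ) :
    semigroupRing k (AddSubmonoid.closure {3, l}) :=
  mono k 3 (three_mem l) * mono k l (self_mem l)

theorem coe_famGen (c : k) : (famGen l c : k⟦X⟧) = X ^ 6 - C c * X ^ l := by
  show (X ^ 3) ^ 2 - C c * X ^ l = _
  rw [← pow_mul]

theorem coe_famGen' : (famGen' k l : k⟦X⟧) = X ^ (l + 3) := by
  show X ^ 3 * X ^ l = _
  rw [← pow_add, add_comm]

theorem coeff_mul_famGen (c : k) (a : semigroupRing k (AddSubmonoid.closure {3, l})) (n : ℕ) :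
    coeff n ((a * famGen l c : semigroupRing k _) : k⟦X⟧) =
      (if 6 ≤ n then coeff (n - 6) (a : k⟦X⟧) else 0) -
        c * (if l ≤ n then coeff (n - l) (a : k⟦X⟧) else 0) := by
  have : ((a * famGen l c : semigroupRing k _) : k⟦X⟧) =
      X ^ 6 * (a : k⟦X⟧) - C c * (X ^ l * (a : k⟦X⟧)) := by
    show (a : k⟦X⟧) * (famGen l c : k⟦X⟧) = _
    rw [coe_famGen]
    ring
  rw [this, map_sub, coeff_C_mul, coeff_X_pow_mul', coeff_X_pow_mul']

theorem coeff_mul_famGen' (a : semigroupRing k (AddSubmonoid.closure {3, l})) (n : ℕ) :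
    coeff n ((a * famGen' k l : semigroupRing k _) : k⟦X⟧) =
      if l + 3 ≤ n then coeff (n - (l + 3)) (a : k⟦X⟧) else 0 := by
  have : ((a * famGen' k l : semigroupRing k _) : k⟦X⟧) = X ^ (l + 3) * (a : k⟦X⟧) := by
    show (a : k⟦X⟧) * (famGen' k l : k⟦X⟧) = _
    rw [coe_famGen', mul_comm]
  rw [this, coeff_X_pow_mul']

theorem mono_three_cube_mem (c : k) :
    mono k 3 (three_mem l) ^ 3 ∈ Ideal.span {famGen l c, famGen' k l} :=
  Ideal.mem_span_pair.2 ⟨mono k 3 (three_mem l), algebraMap k _ c, by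
    rw [famGen, famGen']; ring⟩

theorem mono_sq_mem {c : k} (hc : c ≠ 0) :
    mono k l (self_mem l) ^ 2 ∈ Ideal.span {famGen l c, famGen' k l} := by
  have h : algebraMap k (semigroupRing k (AddSubmonoid.closure {3, l})) c⁻¹ *
      algebraMap k _ c = 1 := by
    rw [← map_mul, inv_mul_cancel₀ hc, map_one]
  refine Ideal.mem_span_pair.2 ⟨-(algebraMap k _ c⁻¹ * mono k l (self_mem l)),
    algebraMap k _ c⁻¹ * mono k 3 (three_mem l), ?_⟩
  rw [famGen, famGen']
  linear_combination mono k l (self_mem l) ^ 2 * h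

/-- The ideal `(t ^ 6 - c t ^ l, t ^ (l + 3))` has colength three: it is cut out by three linear
conditions on the coefficients. -/
theorem mem_fam_iff (hl : 7 ≤ l) (hl3 : l % 3 ≠ 0) {c : k} (hc : c ≠ 0)
    {x : semigroupRing k (AddSubmonoid.closure {3, l})} :
    x ∈ Ideal.span {famGen l c, famGen' k l} ↔ coeff 0 (x : k⟦X⟧) = 0 ∧
      coeff 3 (x : k⟦X⟧) = 0 ∧ c * coeff 6 (x : k⟦X⟧) + coeff l (x : k⟦X⟧) = 0 := by
  constructor
  · intro h
    obtain ⟨a, b, rfl⟩ := Ideal.mem_span_pair.1 h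
    have h1 : coeff (l - 6) (a : k⟦X⟧) = 0 :=
      coeff_eq_zero a (by rw [mem_closure_three_iff]; omega)
    have h2 : ∀ n, coeff n ((a * famGen l c + b * famGen' k l : semigroupRing k _) : k⟦X⟧) =
      coeff n ((a * famGen l c : semigroupRing k _) : k⟦X⟧) +
      coeff n ((b * famGen' k l : semigroupRing k _) : k⟦X⟧) := fun n => by simp
    simp only [h2, coeff_mul_famGen, coeff_mul_famGen']
    refine ⟨?_, ?_, ?_⟩
    · rw [if_neg (by omega), if_neg (by omega), if_neg (by omega)]; ring
    · rw [if_neg (by omega), if_neg (by omega), if_neg (by omega)]; ring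
    · rw [if_pos (by omega), if_neg (by omega), if_neg (by omega), if_pos (by omega),
        if_pos (by omega), if_neg (by omega), h1]
      simp
  · rintro ⟨h0, h3, h6⟩
    set I := Ideal.span {famGen l c, famGen' k l} with hI
    set b := algebraMap k (semigroupRing k (AddSubmonoid.closure {3, l})) (coeff 6 (x : k⟦X⟧))
      with hb
    have hbc : ∀ n, coeff n (b : k⟦X⟧) = if n = 0 then coeff 6 (x : k⟦X⟧) else 0 :=
      fun n => coeff_C n _
    have hmem : x - b * famGen l c ∈ I := by
      refine mem_of_support {9, l + 3, 2 * l} ?_ ?_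
      · simp only [Finset.mem_insert, Finset.mem_singleton, forall_eq_or_imp, forall_eq]
        refine ⟨⟨_, mono_three_cube_mem c, ?_⟩, ⟨famGen' k l, Ideal.subset_span (by simp),
          coe_famGen'⟩, ⟨_, mono_sq_mem hc, ?_⟩⟩
        · show ((X : k⟦X⟧) ^ 3) ^ 3 = X ^ 9
          rw [← pow_mul]
        · show ((X : k⟦X⟧) ^ l) ^ 2 = X ^ (2 * l)
          rw [← pow_mul, mul_comm]
      · intro n hn
        have hnH := (mem_closure_three_iff n).1 ((x - b * famGen l c).2 n hn)
        have hsub : coeff n ((x - b * famGen l c : semigroupRing k _) : k⟦X⟧) =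
          coeff n (x : k⟦X⟧) - coeff n ((b * famGen l c : semigroupRing k _) : k⟦X⟧) := by simp
        rw [hsub, coeff_mul_famGen, hbc, hbc] at hn
        have hn0 : n ≠ 0 := by
          rintro rfl
          rw [if_neg (by omega), if_neg (by omega), h0] at hn
          simp at hn
        have hn3 : n ≠ 3 := by
          rintro rfl
          rw [if_neg (by omega), if_neg (by omega), h3] at hn
          simp at hn
        have hn6 : n ≠ 6 := by
          rintro rfl
          simp [show ¬ l ≤ 6 by omega] at hn
        have hnl : n ≠ l := by
          rintro rfl
          rw [if_pos (by omega), if_neg (by omega), if_pos (by omega), if_pos (by omega)] at hn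
          apply hn
          linear_combination h6
        simp only [Finset.mem_insert, Finset.mem_singleton, exists_eq_or_imp, exists_eq_left,
          mem_closure_three_iff]
        rcases hnH with h | h | h
        · exact Or.inl ⟨n - 9, by omega, by omega⟩
        · exact Or.inr (Or.inl ⟨n - (l + 3), by omega, by omega⟩)
        · exact Or.inr (Or.inr ⟨n - 2 * l, by omega, by omega⟩)
    have := I.add_mem hmem (I.mul_mem_left b (Ideal.subset_span (by simp : famGen l c ∈ _)))
    simpa using this

/-- Write `X = t ^ 3`, `Y = t ^ l`, `f = X ^ 2 - c Y` and `g = X Y`. Modulo `f` one can trade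
`X ^ 2` for `c Y`; together with `Y ^ 3 = X ^ l` this gives
`g ^ 2 (1 - c ^ 3 X ^ (l - 6)) ∈ f (f, g)`, where the factor is a unit because `l ≥ 7`. The colon
condition is read off from
`f (X ^ 4 + c X ^ 2 Y + c ^ 2 Y ^ 2) = X ^ 6 (1 - c ^ 3 X ^ (l - 6))`. -/
theorem isUlrichIdeal_fam (hl : 7 ≤ l) (hl3 : l % 3 ≠ 0) {c : k} (hc : c ≠ 0) :
    IsUlrichIdeal (Ideal.span {famGen l c, famGen' k l}) := by
  obtain ⟨m, hm⟩ := Nat.exists_eq_add_of_le hl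
  have hrel : mono k l (self_mem l) ^ 3 = mono k 3 (three_mem l) ^ (m + 7) := by
    refine Subtype.ext ?_
    show ((X : k⟦X⟧) ^ l) ^ 3 = (X ^ 3) ^ (m + 7)
    rw [← pow_mul, ← pow_mul, hm]
    ring
  have hcube := mono_three_cube_mem (l := l) c
  have hsq := mono_sq_mem (l := l) hc
  have hf0 : famGen l c ≠ 0 := by
    intro h
    have h1 := congrArg (fun y : semigroupRing k _ => coeff 6 (y : k⟦X⟧)) h
    simp only [coe_famGen] at h1
    rw [map_sub, coeff_C_mul, coeff_X_pow, coeff_X_pow, if_pos rfl, if_neg (by omega)] at h1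
    simp at h1
  have hfm : famGen l c ∈ maximalIdeal _ := by
    rw [mem_maximalIdeal, coe_famGen, map_sub, coeff_C_mul, coeff_X_pow, coeff_X_pow,
      if_neg (by omega), if_neg (by omega)]
    simp
  have hgm : famGen' k l ∈ maximalIdeal _ := by
    rw [mem_maximalIdeal, coe_famGen', coeff_X_pow, if_neg (by omega)]
  refine isUlrichIdeal_span_pair (mem_closure_three_of_le hl3) hf0 hfm hgm ?_ ?_
  · have hu : IsUnit (1 - algebraMap k _ c ^ 3 * mono k 3 (three_mem l) ^ (m + 1)) := by
      by_contra h
      have h1 := (IsLocalRing.mem_maximalIdeal _).2 h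
      have h2 := Ideal.mul_mem_left _ (algebraMap k _ c ^ 3)
        (Ideal.pow_mem_of_mem _ (mono_mem_maximalIdeal (k := k) (three_mem l) (by omega))
          (m + 1) (by omega))
      exact (Ideal.ne_top_iff_one _).1
        (maximalIdeal.isMaximal (semigroupRing k (AddSubmonoid.closure {3, l}))).ne_top
        (by simpa using Ideal.add_mem _ h1 h2)
    obtain ⟨w, hw⟩ := hu.exists_right_inv
    rw [Ideal.mem_span_singleton_mul]
    refine ⟨w * (mono k l (self_mem l) ^ 2 +
      (algebraMap k _ c * mono k 3 (three_mem l) ^ (m + 2) +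
      algebraMap k _ c ^ 2 * mono k 3 (three_mem l) ^ m * mono k l (self_mem l)) *
        mono k 3 (three_mem l) ^ 3),
      Ideal.mul_mem_left _ _ (Ideal.add_mem _ hsq (Ideal.mul_mem_left _ _ hcube)), ?_⟩
    simp only [famGen, famGen'] at *
    linear_combination (mono k 3 (three_mem l) ^ 2 * mono k l (self_mem l) ^ 2) * hw -
      algebraMap k _ c * w * hrel
  · rintro x ⟨y, hy⟩
    rw [mem_fam_iff hl hl3 hc]
    set z := y * (1 - algebraMap k _ c ^ 3 * mono k 3 (three_mem l) ^ (m + 1)) -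
      algebraMap k _ c ^ 2 * x * mono k 3 (three_mem l) ^ (m + 2) with hz
    have h1 : x * (mono k 3 (three_mem l) ^ 2 * mono k l (self_mem l) +
        algebraMap k _ c * mono k l (self_mem l) ^ 2) = mono k 3 (three_mem l) ^ 3 * z := by
      apply mul_left_cancel₀ (pow_ne_zero 3 (mono_ne_zero (k := k) 3 (three_mem l)))
      rw [hz]
      simp only [famGen, famGen'] at hy
      linear_combination (mono k 3 (three_mem l) ^ 4 +
        algebraMap k _ c * mono k 3 (three_mem l) ^ 2 * mono k l (self_mem l) +
        algebraMap k _ c ^ 2 * mono k l (self_mem l) ^ 2) * hy - (algebraMap k _ c ^ 3 * y +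
        algebraMap k _ c ^ 2 * x * mono k 3 (three_mem l)) * hrel
    clear_value z
    have h2 : X ^ (l + 6) * (x : k⟦X⟧) + C c * (X ^ (2 * l) * (x : k⟦X⟧)) =
        X ^ 9 * (z : k⟦X⟧) := by
      have h3 : (x : k⟦X⟧) * ((X ^ 3) ^ 2 * X ^ l + C c * (X ^ l) ^ 2) = (X ^ 3) ^ 3 * (z : k⟦X⟧) := by
        have hcc : ((algebraMap k (semigroupRing k (AddSubmonoid.closure {3, l})) c :
          semigroupRing k _) : k⟦X⟧) = C c := rfl
        have h4 := congrArg (semigroupRing k (AddSubmonoid.closure {3, l})).val h1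
        simpa only [map_mul, map_add, map_pow, Subalgebra.coe_val, coe_mono, hcc] using h4
      rw [← pow_mul, ← pow_mul, ← pow_mul, ← pow_add] at h3
      rw [← h3, mul_comm l 2, add_comm 6 l]
      ring
    have h3 : ∀ n, 2 * l ≤ n → coeff (n - (l + 6)) (x : k⟦X⟧) +
        c * coeff (n - 2 * l) (x : k⟦X⟧) = coeff (n - 9) (z : k⟦X⟧) := by
      intro n hn
      have := congrArg (coeff n) h2
      rwa [map_add, coeff_C_mul, coeff_X_pow_mul', coeff_X_pow_mul', coeff_X_pow_mul',
        if_pos (by omega), if_pos (by omega), if_pos (by omega)] at this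
    have hx0 : ∀ n, n % 3 = l % 3 → n < l → coeff n (x : k⟦X⟧) = 0 := fun n h h' =>
      coeff_eq_zero x (by rw [mem_closure_three_iff]; omega)
    have hz0 : ∀ n, n % 3 = (2 * l) % 3 → n < 2 * l → coeff n (z : k⟦X⟧) = 0 := fun n h h' =>
      coeff_eq_zero z (by rw [mem_closure_three_iff]; omega)
    -- The coefficients of `z` in degrees `2l - 9`, `2l - 6`, `2l - 3` vanish, as these are gaps.
    have e0 := h3 (2 * l) le_rfl
    have e3 := h3 (2 * l + 3) (by omega)
    have e6 := h3 (2 * l + 6) (by omega)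
    rw [hz0 _ (by omega) (by omega)] at e0 e3 e6
    rw [hx0 _ (by omega) (by omega)] at e0 e3
    refine ⟨?_, ?_, ?_⟩
    · simpa [hc] using e0
    · simpa [hc] using e3
    · rw [show 2 * l + 6 - (l + 6) = l by omega, show 2 * l + 6 - 2 * l = 6 by omega] at e6
      linear_combination e6

theorem fam_injective (hl : 7 ≤ l) (hl3 : l % 3 ≠ 0) {c d : k} (hc : c ≠ 0)
    (h : Ideal.span {famGen l c, famGen' k l} = Ideal.span {famGen l d, famGen' k l}) : c = d := by
  have h1 : famGen l d ∈ Ideal.span {famGen l c, famGen' k l} := by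
    rw [h]
    exact Ideal.subset_span (by simp)
  have h2 := ((mem_fam_iff hl hl3 hc).1 h1).2.2
  rw [coe_famGen, map_sub, map_sub, coeff_C_mul, coeff_C_mul, coeff_X_pow, coeff_X_pow,
    coeff_X_pow, coeff_X_pow, if_pos rfl, if_neg (by omega), if_neg (by omega), if_pos rfl] at h2
  linear_combination h2

end Family

/-! ### Monomial ideals -/

/-- The exponents of the monomials contained in an ideal of `k[[H]]`. -/
def exponents (I : Ideal (semigroupRing k H)) : Set ℕ :=
  {n | ∃ y ∈ I, (y : k⟦X⟧) = X ^ n}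

theorem exponents_subset (I : Ideal (semigroupRing k H)) {n : ℕ} (hn : n ∈ exponents I) :
    n ∈ H := by
  obtain ⟨y, -, hy⟩ := hn
  exact y.2 n (by rw [hy, coeff_X_pow_self]; exact one_ne_zero)

theorem mono_mem_iff {I : Ideal (semigroupRing k H)} {n : ℕ} (hn : n ∈ H) :
    mono k n hn ∈ I ↔ n ∈ exponents I := by
  refine ⟨fun h => ⟨_, h, rfl⟩, ?_⟩
  rintro ⟨y, hy, hyn⟩
  rwa [show mono k n hn = y from Subtype.ext hyn.symm]

theorem exponents_add (I : Ideal (semigroupRing k H)) {h e : ℕ} (hh : h ∈ H)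
    (he : e ∈ exponents I) : h + e ∈ exponents I := by
  obtain ⟨y, hy, hye⟩ := he
  refine ⟨mono k h hh * y, I.mul_mem_left _ hy, ?_⟩
  show X ^ h * (y : k⟦X⟧) = _
  rw [hye, pow_add]

theorem exists_of_coeff_mul_ne_zero {x y : k⟦X⟧} {n : ℕ} (h : coeff n (x * y) ≠ 0) :
    ∃ i j, i + j = n ∧ coeff i x ≠ 0 ∧ coeff j y ≠ 0 := by
  rw [coeff_mul] at h
  obtain ⟨p, hp, hpn⟩ := Finset.exists_ne_zero_of_sum_ne_zero h
  exact ⟨p.1, p.2, Finset.HasAntidiagonal.mem_antidiagonal.mp hp, left_ne_zero_of_mul hpn, right_ne_zero_of_mul hpn⟩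

/-- A monomial ideal contains every monomial that occurs in one of its elements. -/
theorem mem_exponents_of_coeff_ne_zero {I : Ideal (semigroupRing k H)} (hI : IsMonomialIdeal I)
    {x : semigroupRing k H} (hx : x ∈ I) {n : ℕ} (hn : coeff n (x : k⟦X⟧) ≠ 0) :
    n ∈ exponents I := by
  obtain ⟨S, hS, hIS⟩ := hI
  rw [hIS] at hx
  induction hx using Submodule.span_induction generalizing n with
  | mem x h =>
    obtain ⟨m, hm⟩ := hS x h
    rw [hm, coeff_X_pow] at hn
    split_ifs at hn with hnm
    · rw [hnm, hIS]
      exact ⟨x, Ideal.subset_span h, hm⟩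
    · exact absurd rfl hn
  | zero => exact absurd (map_zero _) hn
  | add x y _ _ hx hy =>
    by_cases h : coeff n (x : k⟦X⟧) = 0
    · exact hy (by simpa [h] using hn)
    · exact hx h
  | smul a x _ hx =>
    obtain ⟨i, j, rfl, hi, hj⟩ := exists_of_coeff_mul_ne_zero
      (show coeff n ((a : k⟦X⟧) * (x : k⟦X⟧)) ≠ 0 from hn)
    exact exponents_add I (a.2 i hi) (hx hj)

theorem exists_of_coeff_ne_zero_of_mem_maximalIdeal_mul {I : Ideal (semigroupRing k H)}
    (hI : IsMonomialIdeal I) {x : semigroupRing k H} (hx : x ∈ maximalIdeal _ * I) {n : ℕ}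
    (hn : coeff n (x : k⟦X⟧) ≠ 0) : ∃ h ∈ H, 0 < h ∧ ∃ e ∈ exponents I, n = h + e := by
  induction hx using Submodule.mul_induction_on' generalizing n with
  | mem_mul_mem a ha x hx =>
    obtain ⟨i, j, rfl, hi, hj⟩ := exists_of_coeff_mul_ne_zero
      (show coeff n ((a : k⟦X⟧) * (x : k⟦X⟧)) ≠ 0 from hn)
    refine ⟨i, a.2 i hi, ?_, j, mem_exponents_of_coeff_ne_zero hI hx hj, rfl⟩
    rcases Nat.eq_zero_or_pos i with rfl | h
    · exact absurd (mem_maximalIdeal.1 ha) hi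
    · exact h
  | add x _ y _ hx hy =>
    by_cases h : coeff n (x : k⟦X⟧) = 0
    · exact hy (by simpa [h] using hn)
    · exact hx h

variable {l : ℕ}

/-- For `l = 2 q` the ideal `(t ^ l, t ^ (3 q))` is Ulrich: the corresponding overring is
`k[[t ^ 3, t ^ q]]`. -/
theorem isUlrichIdeal_mono {q : ℕ} (hq : (2 * q) % 3 ≠ 0)
    (h : 3 * q ∈ AddSubmonoid.closure ({3, 2 * q} : Set ℕ)) :
    IsUlrichIdeal (Ideal.span {mono k (2 * q) (self_mem (2 * q)), mono k (3 * q) h}) := by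
  have hq0 : 0 < q := by omega
  refine isUlrichIdeal_span_pair (mem_closure_three_of_le hq) (mono_ne_zero _ _)
    (mono_mem_maximalIdeal _ (by omega)) (mono_mem_maximalIdeal _ (by omega)) ?_ ?_
  · rw [Ideal.mem_span_singleton_mul]
    refine ⟨mono k (2 * q) (self_mem (2 * q)) ^ 2,
      Ideal.pow_mem_of_mem _ (Ideal.subset_span (by simp)) 2 (by norm_num), Subtype.ext ?_⟩
    show (X : k⟦X⟧) ^ (2 * q) * (X ^ (2 * q)) ^ 2 = (X ^ (3 * q)) ^ 2
    ring
  · rintro x ⟨y, hy⟩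
    have hy' : X ^ (3 * q) * (x : k⟦X⟧) = X ^ (2 * q) * (y : k⟦X⟧) := by
      rw [mul_comm]
      exact congrArg Subtype.val hy
    refine mem_of_support {2 * q, 3 * q} ?_ ?_
    · simp only [Finset.mem_insert, Finset.mem_singleton, forall_eq_or_imp, forall_eq]
      exact ⟨⟨_, Ideal.subset_span (by simp), coe_mono _ (self_mem (2 * q))⟩,
        ⟨_, Ideal.subset_span (by simp), coe_mono _ h⟩⟩
    · intro n hn
      have hnH := (mem_closure_three_iff n).1 (x.2 n hn)
      have h1 := congrArg (coeff (n + 3 * q)) hy'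
      rw [coeff_X_pow_mul, coeff_X_pow_mul', if_pos (by omega)] at h1
      have hnq := (mem_closure_three_iff _).1 (y.2 _ (h1 ▸ hn))
      simp only [Finset.mem_insert, Finset.mem_singleton, exists_eq_or_imp, exists_eq_left,
        mem_closure_three_iff]
      by_cases h2 : 3 * q ≤ n ∧ n % 3 = 0
      · exact Or.inr ⟨n - 3 * q, by omega, by omega⟩
      · refine Or.inl ⟨n - 2 * q, ?_, ?_⟩
        · clear h1 hy' hn
          omega
        · omega

/-- If `k[[t ^ 3, t ^ l]]` has a monomial Ulrich ideal, then `l` is even: the exponents of the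
monomials in the ideal satisfy the hypotheses of `even_of_exponents`. -/
theorem even_of_isMonomialIdeal (hl3 : l % 3 ≠ 0)
    {I : Ideal (semigroupRing k (AddSubmonoid.closure {3, l}))} (hI : IsUlrichIdeal I)
    (hmon : IsMonomialIdeal I) : Even l := by
  have hN := mem_closure_three_of_le hl3
  obtain ⟨f, hfI, hf, hne, hsq⟩ := exists_reduction hN hI
  have hmin := fun x (hx : x ∈ I) => order_le_of_sq_eq hfI hf hsq hx
  have hIm : I ≤ maximalIdeal _ := hI.1 ▸ Ideal.le_radical
  have hfree := hI.2.2
  set a := (f : k⟦X⟧).order.toNat with ha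
  have haE : a ∈ exponents I :=
    mem_exponents_of_coeff_ne_zero hmon hfI (coeff_order (coe_ne_zero hf))
  have haH := exponents_subset I haE
  have hforder : (f : k⟦X⟧).order = a := (coe_toNat_order (coe_ne_zero hf)).symm
  have hminE : ∀ e ∈ exponents I, a ≤ e := by
    rintro e ⟨y, hy, hye⟩
    have := hmin y hy
    rw [hye, order_X_pow, hforder] at this
    exact_mod_cast this
  have ha0 : 0 < a := by
    rcases Nat.eq_zero_or_pos a with h | h
    · exact absurd (mem_maximalIdeal.1 (hIm hfI)) (h ▸ coeff_order (coe_ne_zero hf))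
    · exact h
  refine even_of_exponents hl3 (H := (· ∈ AddSubmonoid.closure {3, l})) (E := (· ∈ exponents I))
    mem_closure_three_iff (fun n => exponents_subset I) (fun h e => exponents_add I) haE ha0 hminE
    ?_ ?_ ?_
  · rintro e e' ⟨y, hy, hye⟩ ⟨y', hy', hye'⟩
    have h1 : y * y' ∈ Ideal.span {f} * I := by
      rw [← hsq, pow_two]
      exact Ideal.mul_mem_mul hy hy'
    obtain ⟨i, hi, hfi⟩ := Ideal.mem_span_singleton_mul.1 h1
    have h2 : (f : k⟦X⟧) * (i : k⟦X⟧) = X ^ (e + e') := by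
      rw [pow_add, ← hye, ← hye']
      exact congrArg Subtype.val hfi
    have hi0 : (i : k⟦X⟧) ≠ 0 := by
      intro h
      rw [h, mul_zero] at h2
      exact pow_ne_zero _ X_ne_zero h2.symm
    refine ⟨(i : k⟦X⟧).order.toNat, mem_exponents_of_coeff_ne_zero hmon hi (coeff_order hi0), ?_⟩
    have h3 := congrArg order h2
    rw [order_mul, order_X_pow, hforder, ← coe_toNat_order hi0] at h3
    exact_mod_cast h3.symm
  · intro v hv hv1 hv2 x h hx hh hxv
    rw [← mono_mem_iff hx]
    have hvH := exponents_subset I hv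
    refine mem_of_mul_mem_span_sup_sq hIm ((mono_mem_iff haH).2 haE) ((mono_mem_iff hvH).2 hv)
      (notMem_maximalIdeal_mul (mono_ne_zero _ _) ?_) ?_ (Ideal.mem_sup_left ?_)
    · intro y hy
      rw [coe_mono, order_X_pow, ← hforder]
      exact hmin y hy
    · intro hcon
      obtain ⟨p, hp, z, hz, hpz⟩ := Submodule.mem_sup.1 hcon
      obtain ⟨w, rfl⟩ := Ideal.mem_span_singleton'.1 hp
      have h1 : (w : k⟦X⟧) * X ^ a + (z : k⟦X⟧) = X ^ v := congrArg Subtype.val hpz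
      have h2 := congrArg (coeff v) h1
      rw [map_add, coeff_mul_X_pow', coeff_X_pow_self, if_pos (hminE v hv)] at h2
      by_cases h3 : coeff v (z : k⟦X⟧) = 0
      · rw [h3, add_zero] at h2
        refine hv1 (v - a) (w.2 _ (by rw [h2]; exact one_ne_zero)) ?_
        have := hminE v hv
        omega
      · obtain ⟨h', hh', h0, e, he, hve⟩ :=
          exists_of_coeff_ne_zero_of_mem_maximalIdeal_mul hmon hz h3
        exact hv2 h' e hh' h0 he hve
    · rw [Ideal.mem_span_singleton']
      refine ⟨mono k h hh, Subtype.ext ?_⟩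
      show (X : k⟦X⟧) ^ h * X ^ a = X ^ x * X ^ v
      rw [← pow_add, ← pow_add, hxv]
  · by_contra! hcon
    have hle : I ≤ Ideal.span {mono k a haH} := by
      intro y hy
      refine mem_of_support {a} (fun e he => ?_) ?_
      · rw [Finset.mem_singleton.1 he]
        exact ⟨_, Ideal.mem_span_singleton_self _, coe_mono _ haH⟩
      · intro n hn
        obtain ⟨h, hh, hnh⟩ := hcon n (mem_exponents_of_coeff_ne_zero hmon hy hn)
        exact ⟨a, by simp, h, hh, hnh⟩
    obtain ⟨w, hw⟩ := Ideal.mem_span_singleton'.1 (hle hfI)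
    have hw' : (w : k⟦X⟧) * X ^ a = (f : k⟦X⟧) := congrArg Subtype.val hw
    have hu : IsUnit w := by
      apply isUnit_semigroupRing
      have h1 := coeff_order (coe_ne_zero hf)
      rw [← ha, ← hw', coeff_mul_X_pow', if_pos le_rfl, Nat.sub_self,
        coeff_zero_eq_constantCoeff_apply] at h1
      exact h1
    apply hne
    refine le_antisymm (hle.trans ?_) (by rwa [Ideal.span_singleton_le_iff_mem])
    rw [← hw, Ideal.span_singleton_mul_left_unit hu]

end semigroupRing

theorem corollary3p11 (k : Type*) [Field k] (l : ℕ) (hl : 7 ≤ l) (hgcd : Nat.gcd 3 l = 1) :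
    (ulrichIdeals (semigroupRing k (AddSubmonoid.closure {3, l}))).Nonempty ∧
    ((ulrichIdeals (semigroupRing k (AddSubmonoid.closure {3, l}))).Finite ↔ Finite k) ∧
    ((¬ ∃ I ∈ ulrichIdeals (semigroupRing k (AddSubmonoid.closure {3, l})), IsMonomialIdeal I) ↔
      ((∃ n : ℕ, 2 ≤ n ∧ Even n ∧ l = 3 * n + 1) ∨
        (∃ n : ℕ, 3 ≤ n ∧ Odd n ∧ l = 3 * n + 2))) := by
  have hl3 : l % 3 ≠ 0 := fun h => by
    rw [Nat.gcd_eq_left (Nat.dvd_of_mod_eq_zero h)] at hgcd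
    omega
  refine ⟨⟨_, semigroupRing.isUlrichIdeal_fam hl hl3 (one_ne_zero (α := k))⟩,
    ⟨fun h => ?_, fun h =>
      semigroupRing.finite_ulrichIdeals (semigroupRing.mem_closure_three_of_le hl3)⟩, ?_⟩
  · have h1 : ({0}ᶜ : Set k).Finite := by
      refine Set.Finite.of_finite_image (f := fun c => Ideal.span
        {semigroupRing.famGen l c, semigroupRing.famGen' k l}) (h.subset ?_) ?_
      · rintro _ ⟨c, hc, rfl⟩
        exact semigroupRing.isUlrichIdeal_fam hl hl3 hc
      · intro c hc d hd hcd
        exact semigroupRing.fam_injective hl hl3 hc hcd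
    have h2 := (Set.finite_singleton (0 : k)).union h1
    rw [Set.union_compl_self] at h2
    exact Set.finite_univ_iff.1 h2
  · -- Both sides of the third claim say that `l` is odd.
    have hodd : ((∃ n : ℕ, 2 ≤ n ∧ Even n ∧ l = 3 * n + 1) ∨
        (∃ n : ℕ, 3 ≤ n ∧ Odd n ∧ l = 3 * n + 2)) ↔ ¬ Even l := by
      simp only [Nat.even_iff, Nat.odd_iff]
      constructor
      · rintro (⟨n, h1, h2, h3⟩ | ⟨n, h1, h2, h3⟩) <;> omega
      · intro h
        obtain h1 | h1 : l % 3 = 1 ∨ l % 3 = 2 := by omega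
        · exact Or.inl ⟨l / 3, by omega, by omega, by omega⟩
        · exact Or.inr ⟨l / 3, by omega, by omega, by omega⟩
    rw [hodd, not_iff_not]
    constructor
    · rintro ⟨I, hI, hmon⟩
      exact semigroupRing.even_of_isMonomialIdeal hl3 hI hmon
    · intro h
      obtain ⟨q, rfl⟩ := h.two_dvd
      have h3q : 3 * q ∈ AddSubmonoid.closure ({3, 2 * q} : Set ℕ) := by
        rw [semigroupRing.mem_closure_three_iff]
        omega
      refine ⟨_, semigroupRing.isUlrichIdeal_mono hl3 h3q, _, ?_, rfl⟩
      rintro f (rfl | rfl)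
      · exact ⟨2 * q, rfl⟩
      · exact ⟨3 * q, rfl⟩
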